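/- Let $D\subset\mathbb C$ be the open unit disc, $T=\partial D$ the unit circle, and $\sigma$ the normalized Haar measure on the torus $T^2=T\times T$. Let $H^2(D^2)$ be the closure in $L^2(T^2,\sigma)$ of the polynomials in $z_1,z_2$, and let $P$ be the orthogonal projection of $L^2(T^2,\sigma)$ onto $H^2(D^2)$. For $f\in L^\infty(T^2,\sigma)$ let $H_f\colon H^2(D^2)\to L^2(T^2,\sigma)$ be the Hankel operator $H_f h=(I-P)(fh)$. Then, for every $f\in L^\infty(T^2,\sigma)$, the operator $H_f$ is compact if and only if $H_f=0$. -/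

import Mathlib

open MeasureTheory
open scoped ENNReal

namespace Bidisc

/-- The unit circle carries its Borel sigma-algebra. -/
noncomputable instance circleMeasurableSpace : MeasurableSpace Circle := borel Circle

instance circleBorelSpace : BorelSpace Circle := ⟨rfl⟩

/-- The torus `T²`, the product of two copies of the unit circle of `ℂ`. -/
abbrev Torus2 : Type := Circle × Circle

/-- The normalized Haar measure `σ` on the compact group `T²`
(the Haar measure giving the whole group mass one). -/
noncomputable def haarTorus2 : Measure Torus2 :=
  Measure.haarMeasure ⊤

/-- `σ` is a probability measure. -/
instance haarTorus2_isProbabilityMeasure : IsProbabilityMeasure haarTorus2 :=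
  ⟨by
    have h := Measure.haarMeasure_self (K₀ := (⊤ : TopologicalSpace.PositiveCompacts Torus2))
    simpa [haarTorus2] using h⟩

/-- `σ` is a Haar measure. -/
instance haarTorus2_isHaarMeasure : haarTorus2.IsHaarMeasure := by
  unfold haarTorus2
  infer_instance

/-- `L²(T²)`. -/
abbrev L2Torus : Type := Lp ℂ 2 haarTorus2

/-- `L^∞(T²)`: essentially bounded functions on `T²`, up to null sets. -/
abbrev LinftyTorus : Type := Lp ℂ ∞ haarTorus2

/-- The monomial `z ↦ z₁ ^ m * z₂ ^ n` as a continuous function on `T²`. -/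
noncomputable def monomial (m n : ℕ) : C(Torus2, ℂ) where
  toFun z := (z.1 : ℂ) ^ m * (z.2 : ℂ) ^ n
  continuous_toFun := by fun_prop

/-- The (analytic) polynomials in `z₁, z₂`, as a linear subspace of `L²(T²)`. -/
noncomputable def polynomials : Submodule ℂ L2Torus :=
  Submodule.span ℂ
    (Set.range fun p : ℕ × ℕ => ContinuousMap.toLp 2 haarTorus2 ℂ (monomial p.1 p.2))

/-- The Hardy space `H²(D²)`: the closure of the polynomials in `L²(T²)`. -/
noncomputable def hardySpace : Submodule ℂ L2Torus :=
  polynomials.topologicalClosure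

/-- `H²(D²)` is complete, so that it has an orthogonal projection. -/
instance hardySpace_completeSpace : CompleteSpace hardySpace :=
  polynomials.isClosed_topologicalClosure.completeSpace_coe

/-- The orthogonal projection `P` of `L²(T²)` onto `H²(D²)`, as an operator on `L²(T²)`. -/
noncomputable def hardyProjection : L2Torus →L[ℂ] L2Torus :=
  hardySpace.starProjection

/-- The operator `h ↦ f h` of multiplication by `f ∈ L^∞(T²)` on `L²(T²)`. -/
noncomputable def multiplication (f : LinftyTorus) : L2Torus →L[ℂ] L2Torus :=
  (ContinuousLinearMap.mul ℂ ℂ).holderL haarTorus2 ∞ 2 2 f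

theorem coeFn_multiplication (f : LinftyTorus) (h : L2Torus) :
    multiplication f h =ᵐ[haarTorus2] fun z => f z * h z :=
  (ContinuousLinearMap.mul ℂ ℂ).coeFn_holder f h

/-- The Hankel operator `H_f : H²(D²) → L²(T²)`, `H_f h = (I - P)(f h)`. -/
noncomputable def hankel (f : LinftyTorus) : hardySpace →L[ℂ] L2Torus :=
  (ContinuousLinearMap.id ℂ L2Torus - hardyProjection) ∘L multiplication f ∘L hardySpace.subtypeL

end Bidisc

/-!
The characters `e k (z) = z₁ ^ k₁ * z₂ ^ k₂`, `k ∈ ℤ²`, form an orthonormal system with dense span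
in `L²(T²)`, and `H²(D²)` is the set of those `g` whose Fourier coefficients `⟪e k, g⟫` vanish
for all `k` outside the quadrant `0 ≤ k` (`mem_hardySpace_iff`).

If `0 ≤ a` and `¬ 0 ≤ k`, the matrix entry `⟪e k, H_f (e a)⟫` is the Fourier coefficient of `f` at
`k - a`. Suppose `H_f` is compact and let `¬ 0 ≤ j`. One coordinate of `j` is negative, and moving
in the direction `b` of the other coordinate never leaves the complement of the quadrant, so
`⟪e (j + n b), H_f (e (n b))⟫` is the Fourier coefficient of `f` at `j` for every `n`. A compact
operator cannot have a nonzero entry repeated along an orthonormal sequence of outputs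
(`eq_zero_of_inner_eq_of_isCompactOperator`), so this coefficient vanishes
(`fourierCoeff_eq_zero_of_isCompactOperator`). Hence `f * e a ∈ H²(D²)` whenever `0 ≤ a`, so
multiplication by `f` preserves `H²(D²)`, which means `H_f = 0`. It is the second variable that
supplies the direction `b`; in one variable the complement of the half-line has no such direction.
-/

namespace Bidisc

open Filter Topology
open scoped InnerProductSpace ComplexConjugate

/-! ### Compact operators and orthonormal sequences -/

/-- If `T` is compact and `⟪u n, T (x n)⟫` takes the same value `c` for every `n`, where `x` is
bounded and `u` is orthonormal, then `c = 0`: along a subsequence `T (x n)` converges to some `y`,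
and `⟪u n, y⟫ → 0` by Bessel's inequality. -/
theorem eq_zero_of_inner_eq_of_isCompactOperator {E F : Type*} [NormedAddCommGroup E]
    [NormedSpace ℂ E] [NormedAddCommGroup F] [InnerProductSpace ℂ F] {T : E →L[ℂ] F}
    (hT : IsCompactOperator T) {x : ℕ → E} {R : ℝ} (hx : ∀ n, ‖x n‖ ≤ R) {u : ℕ → F}
    (hu : Orthonormal ℂ u) {c : ℂ} (hc : ∀ n, ⟪u n, T (x n)⟫_ℂ = c) : c = 0 := by
  have hK := IsCompactOperator.isCompact_closure_image_closedBall (f := (T : E →ₗ[ℂ] F)) hT R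
  obtain ⟨y, -, φ, hφ, hy⟩ := hK.tendsto_subseq (x := fun n => T (x n))
    fun n => subset_closure ⟨x n, by simpa using hx n, rfl⟩
  have hBessel : Tendsto (fun n => ⟪u (φ n), y⟫_ℂ) atTop (𝓝 0) := by
    have h := (hu.inner_products_summable (x := y)).tendsto_atTop_zero.comp hφ.tendsto_atTop
    rw [tendsto_zero_iff_norm_tendsto_zero]
    simpa [Function.comp_def] using h.sqrt
  have hdiff : Tendsto (fun n => ⟪u (φ n), T (x (φ n)) - y⟫_ℂ) atTop (𝓝 0) := by
    refine squeeze_zero_norm (fun n => ?_) (tendsto_iff_norm_sub_tendsto_zero.1 hy)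
    have h := norm_inner_le_norm (𝕜 := ℂ) (u (φ n)) (T (x (φ n)) - y)
    rwa [hu.1 (φ n), one_mul] at h
  have hlim := hdiff.add hBessel
  simp only [inner_sub_right, hc, sub_add_cancel, add_zero] at hlim
  exact tendsto_nhds_unique tendsto_const_nhds hlim

/-! ### Characters of the torus -/

/-- The character `z ↦ z₁ ^ k₁ * z₂ ^ k₂` of `T²`, as a complex-valued continuous function. The
powers are taken in the group `Circle`. -/
noncomputable def character (k : ℤ × ℤ) : C(Torus2, ℂ) where
  toFun z := ((z.1 ^ k.1 * z.2 ^ k.2 : Circle) : ℂ)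
  continuous_toFun := by
    have h : Continuous fun z : Torus2 => z.1 ^ k.1 * z.2 ^ k.2 := by fun_prop
    have hcoe : Continuous ((↑) : Circle → ℂ) := by fun_prop
    exact hcoe.comp h

theorem character_apply (k : ℤ × ℤ) (z : Torus2) :
    character k z = ((z.1 ^ k.1 * z.2 ^ k.2 : Circle) : ℂ) := rfl

theorem character_zero (z : Torus2) : character 0 z = 1 := by
  simp [character_apply]

theorem character_add (k l : ℤ × ℤ) (z : Torus2) :
    character (k + l) z = character k z * character l z := by
  simp only [character_apply, ← Circle.coe_mul, Prod.fst_add, Prod.snd_add, zpow_add]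
  rw [mul_mul_mul_comm]

theorem character_neg (k : ℤ × ℤ) (z : Torus2) : character (-k) z = conj (character k z) := by
  simp only [character_apply, ← Circle.coe_inv_eq_conj, Prod.fst_neg, Prod.snd_neg, zpow_neg,
    mul_inv]

theorem character_mul (k : ℤ × ℤ) (w z : Torus2) :
    character k (w * z) = character k w * character k z := by
  simp only [character_apply, ← Circle.coe_mul, Prod.fst_mul, Prod.snd_mul, mul_zpow]
  rw [mul_mul_mul_comm]

theorem conj_character_mul_self (k : ℤ × ℤ) (z : Torus2) :
    conj (character k z) * character k z = 1 := by
  rw [← character_neg, ← character_add, neg_add_cancel, character_zero]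

theorem exists_circle_zpow_ne_one {m : ℤ} (hm : m ≠ 0) : ∃ w : Circle, w ^ m ≠ 1 := by
  refine ⟨Circle.exp (Real.pi / m), ?_⟩
  rw [← Circle.exp_zsmul, zsmul_eq_mul, mul_div_cancel₀ _ (Int.cast_ne_zero.2 hm)]
  intro h
  have h' := congrArg ((↑) : Circle → ℂ) h
  rw [Circle.coe_exp, Complex.exp_pi_mul_I, Circle.coe_one] at h'
  norm_num at h'

theorem exists_character_ne_one {k : ℤ × ℤ} (hk : k ≠ 0) : ∃ w, character k w ≠ 1 := by
  by_cases h1 : k.1 = 0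
  · have h2 : k.2 ≠ 0 := fun h2 => hk (Prod.ext h1 h2)
    obtain ⟨w, hw⟩ := exists_circle_zpow_ne_one h2
    exact ⟨(1, w), by simpa [character_apply, -Circle.coe_zpow, Circle.coe_eq_one] using hw⟩
  · obtain ⟨w, hw⟩ := exists_circle_zpow_ne_one h1
    exact ⟨(w, 1), by simpa [character_apply, -Circle.coe_zpow, Circle.coe_eq_one] using hw⟩

/-- A nontrivial character integrates to zero: by invariance of `σ` the integral does not change
when it is multiplied by a value of the character different from `1`. -/
theorem integral_character {k : ℤ × ℤ} (hk : k ≠ 0) : ∫ z, character k z ∂haarTorus2 = 0 := by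
  obtain ⟨w, hw⟩ := exists_character_ne_one hk
  have h := integral_mul_left_eq_self (μ := haarTorus2) (fun z => character k z) w
  simp only [character_mul, integral_const_mul] at h
  by_contra h0
  exact hw (mul_right_cancel₀ h0 (h.trans (one_mul _).symm))

/-- The characters span a dense subspace of the continuous functions, by Stone–Weierstrass. -/
theorem span_character_closure_eq_top :
    (Submodule.span ℂ (Set.range character)).topologicalClosure = ⊤ := by
  let A : StarSubalgebra ℂ C(Torus2, ℂ) :=
    { toSubalgebra := Algebra.adjoin ℂ (Set.range character)
      star_mem' := by
        change Algebra.adjoin ℂ (Set.range character) ≤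
          star (Algebra.adjoin ℂ (Set.range character))
        refine Algebra.adjoin_le ?_
        rintro - ⟨k, rfl⟩
        exact Algebra.subset_adjoin
          ⟨-k, ContinuousMap.ext fun z => character_neg k z⟩ }
  have hspan : Subalgebra.toSubmodule A.toSubalgebra = Submodule.span ℂ (Set.range character) := by
    refine Algebra.adjoin_eq_span_of_subset (R := ℂ) (s := Set.range character) ?_
    refine Set.Subset.trans ?_ Submodule.subset_span
    intro x hx
    refine Submonoid.closure_induction (fun _ => id) ⟨0, ?_⟩ ?_ hx
    · ext z
      exact character_zero z
    · rintro - - - - ⟨k, rfl⟩ ⟨l, rfl⟩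
      exact ⟨k + l, ContinuousMap.ext fun z => character_add k l z⟩
  have hsep : A.SeparatesPoints := by
    intro x y hxy
    by_cases h1 : x.1 = y.1
    · have h2 : x.2 ≠ y.2 := fun h2 => hxy (Prod.ext h1 h2)
      refine ⟨_, ⟨character (0, 1), Algebra.subset_adjoin (R := ℂ) ⟨_, rfl⟩, rfl⟩, ?_⟩
      simpa [character_apply, Circle.coe_inj] using h2
    · refine ⟨_, ⟨character (1, 0), Algebra.subset_adjoin (R := ℂ) ⟨_, rfl⟩, rfl⟩, ?_⟩
      simpa [character_apply, Circle.coe_inj] using h1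
  rw [← hspan]
  exact congrArg (fun B : StarSubalgebra ℂ C(Torus2, ℂ) => Subalgebra.toSubmodule B.toSubalgebra)
    (ContinuousMap.starSubalgebra_topologicalClosure_eq_top_of_separatesPoints A hsep)

/-! ### Fourier analysis in `L²(T²)` -/

/-- The character of index `k` as an element of `L²(T²)`. -/
noncomputable def characterL2 (k : ℤ × ℤ) : L2Torus :=
  ContinuousMap.toLp 2 haarTorus2 ℂ (character k)

theorem coeFn_characterL2 (k : ℤ × ℤ) : characterL2 k =ᵐ[haarTorus2] character k :=
  ContinuousMap.coeFn_toLp haarTorus2 (character k)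

theorem orthonormal_characterL2 : Orthonormal ℂ characterL2 := by
  rw [orthonormal_iff_ite]
  intro k l
  rw [characterL2, characterL2, ContinuousMap.inner_toLp haarTorus2 (character k) (character l)]
  simp_rw [← character_neg, ← character_add]
  split_ifs with h
  · simp [h, character_zero]
  · exact integral_character fun h' => h (add_neg_eq_zero.1 h').symm

theorem span_characterL2_closure_eq_top :
    (Submodule.span ℂ (Set.range characterL2)).topologicalClosure = ⊤ := by
  convert! (ContinuousMap.toLp_denseRange ℂ haarTorus2 ℂ
    (ENNReal.ofNat_ne_top (n := 2))).topologicalClosure_map_submodule span_character_closure_eq_top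
  rw [Submodule.map_span, ← Set.range_comp]
  rfl

/-- A function in `L²(T²)` all of whose Fourier coefficients vanish is zero. -/
theorem eq_zero_of_inner_characterL2_eq_zero {g : L2Torus}
    (hg : ∀ k, ⟪characterL2 k, g⟫_ℂ = 0) : g = 0 := by
  have h : g ∈ (Submodule.span ℂ (Set.range characterL2))ᗮ := by
    rw [Submodule.mem_orthogonal]
    intro u hu
    induction hu using Submodule.span_induction with
    | mem x hx => obtain ⟨k, rfl⟩ := hx; exact hg k
    | zero => simp
    | add x y _ _ hx hy => rw [inner_add_left, hx, hy, add_zero]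
    | smul c x _ hx => rw [inner_smul_left, hx, mul_zero]
  rwa [(Submodule.topologicalClosure_eq_top_iff).1 span_characterL2_closure_eq_top] at h

/-! ### The Hardy space in terms of Fourier coefficients -/

theorem range_monomial_eq : (Set.range fun p : ℕ × ℕ =>
    ContinuousMap.toLp 2 haarTorus2 ℂ (monomial p.1 p.2)) = characterL2 '' Set.Ici 0 := by
  have key (p : ℕ × ℕ) : ContinuousMap.toLp 2 haarTorus2 ℂ (monomial p.1 p.2) =
      characterL2 (p.1, p.2) := rfl
  ext x
  constructor
  · rintro ⟨p, rfl⟩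
    exact ⟨(p.1, p.2), by simp [Prod.le_def], (key p).symm⟩
  · rintro ⟨⟨m, n⟩, hk, rfl⟩
    obtain ⟨hm, hn⟩ : 0 ≤ m ∧ 0 ≤ n := hk
    lift m to ℕ using hm
    lift n to ℕ using hn
    exact ⟨(m, n), key (m, n)⟩

theorem hardySpace_eq :
    hardySpace = (Submodule.span ℂ (characterL2 '' Set.Ici 0)).topologicalClosure := by
  rw [hardySpace, polynomials, range_monomial_eq]

theorem characterL2_mem_hardySpace {k : ℤ × ℤ} (hk : 0 ≤ k) : characterL2 k ∈ hardySpace := by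
  rw [hardySpace_eq]
  exact Submodule.le_topologicalClosure _ (Submodule.subset_span ⟨k, hk, rfl⟩)

theorem hardySpace_le {S : Submodule ℂ L2Torus} (hS : IsClosed (S : Set L2Torus))
    (h : ∀ k, 0 ≤ k → characterL2 k ∈ S) : hardySpace ≤ S := by
  rw [hardySpace_eq]
  refine Submodule.topologicalClosure_minimal _ (Submodule.span_le.2 ?_) hS
  rintro - ⟨k, hk, rfl⟩
  exact h k hk

theorem inner_characterL2_of_mem_hardySpace {g : L2Torus} (hg : g ∈ hardySpace) {k : ℤ × ℤ}
    (hk : ¬0 ≤ k) : ⟪characterL2 k, g⟫_ℂ = 0 := by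
  have hle : hardySpace ≤ (ℂ ∙ characterL2 k)ᗮ :=
    hardySpace_le (Submodule.isClosed_orthogonal _) fun l hl => by
      rw [Submodule.mem_orthogonal_singleton_iff_inner_right]
      exact orthonormal_characterL2.2 fun h => hk (h ▸ hl)
  exact Submodule.mem_orthogonal_singleton_iff_inner_right.1 (hle hg)

/-- Functions in `H²(D²)` are those with Fourier coefficients supported in the first quadrant. -/
theorem mem_hardySpace_iff {g : L2Torus} :
    g ∈ hardySpace ↔ ∀ k, ¬0 ≤ k → ⟪characterL2 k, g⟫_ℂ = 0 := by
  refine ⟨fun hg k hk => inner_characterL2_of_mem_hardySpace hg hk, fun hg => ?_⟩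
  have hsub : g - hardySpace.starProjection g = 0 := by
    refine eq_zero_of_inner_characterL2_eq_zero fun k => ?_
    by_cases hk : 0 ≤ k
    · rw [← inner_conj_symm, Submodule.starProjection_inner_eq_zero _ _
        (characterL2_mem_hardySpace hk), map_zero]
    · rw [inner_sub_right, hg k hk, inner_characterL2_of_mem_hardySpace
        (Submodule.starProjection_apply_mem _ g) hk, sub_zero]
  rw [sub_eq_zero.1 hsub]
  exact Submodule.starProjection_apply_mem _ g

/-! ### Matrix entries of Hankel operators -/

/-- The matrix of a multiplication operator is constant along diagonals. -/
theorem inner_characterL2_add_multiplication (f : LinftyTorus) (k a b : ℤ × ℤ) :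
    ⟪characterL2 (k + b), multiplication f (characterL2 (a + b))⟫_ℂ =
      ⟪characterL2 k, multiplication f (characterL2 a)⟫_ℂ := by
  rw [L2.inner_def, L2.inner_def]
  refine integral_congr_ae ?_
  filter_upwards [coeFn_characterL2 (k + b), coeFn_characterL2 k, coeFn_characterL2 (a + b),
    coeFn_characterL2 a, coeFn_multiplication f (characterL2 (a + b)),
    coeFn_multiplication f (characterL2 a)] with z h1 h2 h3 h4 h5 h6
  rw [h1, h2, h5, h6, h3, h4]
  simp only [RCLike.inner_apply, character_add, map_mul]
  linear_combination (f z * character a z * conj (character k z)) * conj_character_mul_self b z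

theorem hankel_apply (f : LinftyTorus) (h : hardySpace) :
    hankel f h = multiplication f h - hardySpace.starProjection (multiplication f h) := rfl

/-- Functionals given by characters outside the quadrant do not see the projection `P`. -/
theorem inner_characterL2_hankel (f : LinftyTorus) (h : hardySpace) {k : ℤ × ℤ} (hk : ¬0 ≤ k) :
    ⟪characterL2 k, hankel f h⟫_ℂ = ⟪characterL2 k, multiplication f h⟫_ℂ := by
  rw [hankel_apply, inner_sub_right, inner_characterL2_of_mem_hardySpace
    (Submodule.starProjection_apply_mem _ _) hk, sub_zero]

/-- A point of `ℤ²` outside the first quadrant can be moved along a coordinate axis, in the positive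
direction, without ever entering the quadrant. -/
theorem exists_direction_not_nonneg {j : ℤ × ℤ} (hj : ¬0 ≤ j) :
    ∃ b : ℤ × ℤ, 0 ≤ b ∧ b ≠ 0 ∧ ∀ n : ℕ, ¬0 ≤ j + n • b := by
  by_cases h1 : 0 ≤ j.1
  · have h2 : ¬0 ≤ j.2 := fun h2 => hj ⟨h1, h2⟩
    exact ⟨(1, 0), by simp [Prod.le_def], by simp, fun n h => h2 (by simpa using h.2)⟩
  · exact ⟨(0, 1), by simp [Prod.le_def], by simp, fun n h => h1 (by simpa using h.1)⟩

/-- The Fourier coefficients of the symbol of a compact Hankel operator vanish outside the first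
quadrant. The product of `f` with the constant `1 = e 0` represents `f` in `L²(T²)`. -/
theorem fourierCoeff_eq_zero_of_isCompactOperator {f : LinftyTorus}
    (hf : IsCompactOperator (hankel f)) {j : ℤ × ℤ} (hj : ¬0 ≤ j) :
    ⟪characterL2 j, multiplication f (characterL2 0)⟫_ℂ = 0 := by
  obtain ⟨b, hb, hb0, hjb⟩ := exists_direction_not_nonneg hj
  have hinj : Function.Injective fun n : ℕ => j + n • b := fun m n hmn => by
    have hmn' : (m : ℤ) • b = (n : ℤ) • b := by simpa using add_left_cancel hmn
    exact_mod_cast smul_left_injective ℤ hb0 hmn'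
  refine eq_zero_of_inner_eq_of_isCompactOperator hf
    (x := fun n => ⟨characterL2 (n • b), characterL2_mem_hardySpace (nsmul_nonneg hb n)⟩)
    (R := 1) (fun n => (orthonormal_characterL2.1 (n • b)).le)
    (orthonormal_characterL2.comp _ hinj) fun n => ?_
  have h := inner_characterL2_add_multiplication f j 0 (n • b)
  rw [zero_add] at h
  exact (inner_characterL2_hankel f _ (hjb n)).trans h

theorem hankel_eq_zero_of_isCompactOperator {f : LinftyTorus}
    (hf : IsCompactOperator (hankel f)) : hankel f = 0 := by
  have hmaps : hardySpace ≤ hardySpace.comap (multiplication f : L2Torus →ₗ[ℂ] L2Torus) := by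
    refine hardySpace_le (polynomials.isClosed_topologicalClosure.preimage
      (multiplication f).continuous) fun a ha => ?_
    change multiplication f (characterL2 a) ∈ hardySpace
    refine mem_hardySpace_iff.2 fun k hk => ?_
    have hka : ¬0 ≤ k - a := fun h => hk (ha.trans (sub_nonneg.1 h))
    have h := inner_characterL2_add_multiplication f (k - a) 0 a
    rw [sub_add_cancel, zero_add] at h
    rw [h, fourierCoeff_eq_zero_of_isCompactOperator hf hka]
  ext1 h
  have hmem : multiplication f h ∈ hardySpace := hmaps h.2
  rw [hankel_apply, Submodule.starProjection_eq_self_iff.2 hmem, sub_self,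
    zero_apply]

end Bidisc

theorem corollary1 (f : Bidisc.LinftyTorus) :
    IsCompactOperator (Bidisc.hankel f) ↔ Bidisc.hankel f = 0 := by
  refine ⟨Bidisc.hankel_eq_zero_of_isCompactOperator, fun h => ?_⟩
  rw [h]
  exact isCompactOperator_zero
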